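/- Let $K$ be a field that is complete with respect to a nontrivial discrete valuation $\mathrm{val}$, normalized by $\mathrm{val}(K^\times)=\mathbb Z$, with finite residue field of cardinality $q$. Put $|x| = q^{-\mathrm{val}(x)}$, let $R=\{x\in K : |x|\le 1\}$ be the ring of integers, and let $d\ge 2$ be an integer. Equip $K^d$ with the norm $\|x\|=\max_i|x_i|$ and with the Haar measure $\mu$ normalized by $\mu(R^d)=1$. For a point $a$ of the projective space $\mathbb P^{d-1}(K)$ (the set of lines of $K^d$ through the origin), a reduced representative of $a$ is a vector of norm $1$ spanning $a$; let $\mathrm{can}(a)$ be the unique reduced representative of $a$ for which there is an index $j$ such that its $j$-th coordinate is $1$ and all its coordinates of index $i<j$ satisfy $|a_i|<1$. Equip $\mathbb P^{d-1}(K)$ with the distance $\mathrm{dist}(a,b)=\inf\|\hat a-\hat b\|$, the infimum being taken over all reduced representatives $\hat a$ of $a$ and $\hat b$ of $b$. Let $\Omega$ be the group (under addition) of all $1$-Lipschitz functions $f:\mathbb P^{d-1}(K)\to R^d$, with the topology of uniform convergence; it is compact, and it is endowed with its Haar probability measure. For $f\in\Omega$ let $$N(f)=\bigcup_{a\in\mathbb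 P^{d-1}(K)}\{\,t\cdot \mathrm{can}(a)+f(a) : t\in R\,\}$$ be the associated projective Kakeya set and, for an integer $n\ge 0$, let $$N_n(f)=\Big\{x\in R^d : \inf_{y\in N(f)}\|x-y\|\le q^{-n}\Big\},\qquad X_n(f)=\mu(N_n(f)).$$ Let $(u_n)_{n\ge 0}$ be defined by $u_0=1$ and $u_{n+1}=1-\left(1-\dfrac{u_n}{q^{d-1}}\right)^{q^{d-1}}$. Then, for all $n \ge 0$, the random variable $X_n$ on $\Omega$ is integrable and $$\mathbb E[X_n]=1-(1-u_n)^{1+q^{-1}+\cdots+q^{-(d-1)}}.$$ -/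

import Mathlib

open scoped NormedField Valued UniformConvergence LinearAlgebra.Projectivization
open MeasureTheory

noncomputable section

namespace Kakeya

/-- The cardinality `q` of the residue field of `K`. -/
def residueCard (K : Type*) [NontriviallyNormedField K] [IsUltrametricDist K] : ℕ :=
  Nat.card 𝓀[K]

/-- `c` is a reduced representative of the point `a` of `ℙ^{d-1}(K)`: it spans the line `a` and has
(sup-)norm one. -/
def IsReduced {K : Type*} [NontriviallyNormedField K] {d : ℕ} (a : ℙ K (Fin d → K))
    (c : Fin d → K) : Prop :=
  (∃ h : c ≠ 0, Projectivization.mk K c h = a) ∧ ‖c‖ = 1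

/-- `c` is a canonical representative of `a`: it is reduced and, for some index `j` (the pivot),
its `j`-th coordinate is `1` and all the previous ones have norm `< 1`. -/
def IsCanonical {K : Type*} [NontriviallyNormedField K] {d : ℕ} (a : ℙ K (Fin d → K))
    (c : Fin d → K) : Prop :=
  IsReduced a c ∧ ∃ j : Fin d, c j = 1 ∧ ∀ i < j, ‖c i‖ < 1

theorem existsUnique_isCanonical {K : Type*} [NontriviallyNormedField K] {d : ℕ}
    (a : ℙ K (Fin d → K)) : ∃! c : Fin d → K, IsCanonical a c := by
  classical
  have hv : a.rep ≠ 0 := a.rep_nonzero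
  have hd : Nonempty (Fin d) := by
    by_contra h
    rw [not_nonempty_iff] at h
    exact hv (Subsingleton.elim _ _)
  have hpos : 0 < ‖a.rep‖ := norm_pos_iff.2 hv
  -- the first index where the sup norm is reached
  have hex : ∃ j, ‖a.rep j‖ = ‖a.rep‖ := by
    obtain ⟨j, hj⟩ := exists_eq_ciSup_of_finite (f := fun j => ‖a.rep j‖)
    refine ⟨j, le_antisymm (norm_le_pi_norm _ j) ?_⟩
    refine (pi_norm_le_iff_of_nonneg (norm_nonneg _)).2 fun i => ?_
    rw [hj]
    exact le_ciSup (f := fun j => ‖a.rep j‖) (Set.finite_range _).bddAbove i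
  obtain ⟨j, hj, hmin⟩ : ∃ j, ‖a.rep j‖ = ‖a.rep‖ ∧ ∀ i < j, ‖a.rep i‖ < ‖a.rep‖ := by
    let S : Finset (Fin d) := Finset.univ.filter fun j => ‖a.rep j‖ = ‖a.rep‖
    have hS : S.Nonempty := by
      obtain ⟨j, hj⟩ := hex
      exact ⟨j, by simp [S, hj]⟩
    refine ⟨S.min' hS, ?_, fun i hi => ?_⟩
    · have := S.min'_mem hS
      simpa [S] using this
    · refine lt_of_le_of_ne (norm_le_pi_norm _ i) fun h => ?_
      exact absurd (S.min'_le i (by simp [S, h])) (not_le.2 hi)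
  have hj0 : a.rep j ≠ 0 := norm_pos_iff.1 (hj ▸ hpos)
  refine ⟨(a.rep j)⁻¹ • a.rep, ⟨⟨⟨smul_ne_zero (inv_ne_zero hj0) hv, ?_⟩, ?_⟩, j, ?_, ?_⟩, ?_⟩
  · conv_rhs => rw [← a.mk_rep]
    rw [Projectivization.mk_eq_mk_iff']
    exact ⟨_, rfl⟩
  · rw [norm_smul, norm_inv, hj, inv_mul_cancel₀ hpos.ne']
  · simp [hj0]
  · intro i hi
    have := hmin i hi
    simp only [Pi.smul_apply, smul_eq_mul, norm_mul, norm_inv, hj]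
    rw [inv_mul_lt_iff₀ hpos, mul_one]
    exact this
  · rintro c ⟨⟨⟨hc0, hc⟩, hc1⟩, k, hk, hlt⟩
    rw [← a.mk_rep, Projectivization.mk_eq_mk_iff'] at hc
    obtain ⟨t, ht⟩ := hc
    have htn : ‖t‖ * ‖a.rep‖ = 1 := by rw [← norm_smul, ht, hc1]
    have hci : ∀ i, c i = t * a.rep i := fun i => by rw [← ht]; rfl
    have hkj : k = j := by
      rcases lt_trichotomy k j with h | h | h
      · have h1 := hmin k h
        have h2 : ‖t‖ * ‖a.rep k‖ = 1 := by rw [← norm_mul, ← hci, hk, norm_one]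
        have ht0 : 0 < ‖t‖ := by
          rcases (norm_nonneg t).eq_or_lt with h | h
          · rw [← h] at h2; simp at h2
          · exact h
        have := mul_lt_mul_of_pos_left h1 ht0
        linarith
      · exact h
      · have h1 := hlt j h
        rw [hci, norm_mul, hj, htn] at h1
        exact absurd h1 (lt_irrefl _)
    subst hkj
    have : t = (a.rep k)⁻¹ := by
      rw [hci] at hk
      exact eq_inv_of_mul_eq_one_left hk
    rw [← ht, this]

/-- The canonical representative `can(a)` of a point `a` of `ℙ^{d-1}(K)`. -/
def can {K : Type*} [NontriviallyNormedField K] {d : ℕ} (a : ℙ K (Fin d → K)) : Fin d → K :=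
  (existsUnique_isCanonical a).choose

theorem can_spec {K : Type*} [NontriviallyNormedField K] {d : ℕ} (a : ℙ K (Fin d → K)) :
    IsCanonical a (can a) :=
  (existsUnique_isCanonical a).choose_spec.1

/-- The distance on `ℙ^{d-1}(K)`: the infimum of `‖x - y‖` over all the reduced representatives
`x` and `y` of the two points. -/
def projDist {K : Type*} [NontriviallyNormedField K] {d : ℕ} (a b : ℙ K (Fin d → K)) : ℝ :=
  sInf {r : ℝ | ∃ x y : Fin d → K, IsReduced a x ∧ IsReduced b y ∧ r = ‖x - y‖}

theorem projDist_nonneg {K : Type*} [NontriviallyNormedField K] {d : ℕ}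
    (a b : ℙ K (Fin d → K)) : 0 ≤ projDist a b := by
  refine Real.sInf_nonneg ?_
  rintro _ ⟨x, y, -, -, rfl⟩
  exact norm_nonneg _

theorem projDist_le {K : Type*} [NontriviallyNormedField K] {d : ℕ}
    {a b : ℙ K (Fin d → K)} {x y : Fin d → K} (hx : IsReduced a x) (hy : IsReduced b y) :
    projDist a b ≤ ‖x - y‖ := by
  refine csInf_le ⟨0, ?_⟩ ⟨x, y, hx, hy, rfl⟩
  rintro _ ⟨x, y, -, -, rfl⟩
  exact norm_nonneg _

/-- The universe `Ω` of all the `1`-Lipschitz functions from `ℙ^{d-1}(K)` to `R^d`, where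
`R = {x | ‖x‖ ≤ 1}`, as a group of functions endowed with the topology of uniform convergence,
which is the one of the norm `sup_a ‖f a‖`. -/
def Omega (K : Type*) [NontriviallyNormedField K] [IsUltrametricDist K] (d : ℕ) :
    AddSubgroup (ℙ K (Fin d → K) →ᵤ (Fin d → K)) where
  carrier := {f | (∀ a, ‖UniformFun.toFun f a‖ ≤ 1) ∧
    ∀ a b, ‖UniformFun.toFun f a - UniformFun.toFun f b‖ ≤ projDist a b}
  zero_mem' := ⟨fun a => by simp, fun a b => by simpa using projDist_nonneg a b⟩
  add_mem' := by
    rintro f g ⟨hf, hf'⟩ ⟨hg, hg'⟩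
    refine ⟨fun a => ?_, fun a b => ?_⟩
    · exact (IsUltrametricDist.norm_add_le_max _ _).trans (max_le (hf a) (hg a))
    · have : UniformFun.toFun (f + g) a - UniformFun.toFun (f + g) b
          = (UniformFun.toFun f a - UniformFun.toFun f b)
            + (UniformFun.toFun g a - UniformFun.toFun g b) := by
        simp only [UniformFun.toFun_add, Pi.add_apply]; abel
      rw [this]
      exact (IsUltrametricDist.norm_add_le_max _ _).trans (max_le (hf' a b) (hg' a b))
  neg_mem' := by
    rintro f ⟨hf, hf'⟩
    refine ⟨fun a => ?_, fun a b => ?_⟩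
    · simpa using hf a
    · have : UniformFun.toFun (-f) a - UniformFun.toFun (-f) b
          = -(UniformFun.toFun f a - UniformFun.toFun f b) := by
        simp only [UniformFun.toFun_neg, Pi.neg_apply]; abel
      rw [this, norm_neg]
      exact hf' a b

instance (K : Type*) [NontriviallyNormedField K] [IsUltrametricDist K] (d : ℕ) :
    MeasurableSpace (Omega K d) := borel _

instance (K : Type*) [NontriviallyNormedField K] [IsUltrametricDist K] (d : ℕ) :
    BorelSpace (Omega K d) := ⟨rfl⟩

theorem properSpace (K : Type*) [NontriviallyNormedField K] [IsUltrametricDist K]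
    [CompleteSpace K] [IsDiscreteValuationRing 𝒪[K]] [Finite 𝓀[K]] : ProperSpace K := by
  have hball : ((𝒪[K] : Set K)) = Metric.closedBall 0 1 := by
    ext x
    simp [Valued.integer.mem_iff]
  have hc : CompleteSpace 𝒪[K] := by
    have : IsClosed (𝒪[K] : Set K) := by rw [hball]; exact Metric.isClosed_closedBall
    exact this.completeSpace_coe
  let : (Valued.v : Valuation K NNReal).RankOne :=
    inferInstanceAs (NormedField.valuation (K := K)).RankOne
  have hcomp : CompactSpace 𝒪[K] :=
    Valued.integer.compactSpace_iff_completeSpace_and_isDiscreteValuationRing_and_finite_residueField.2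
      ⟨hc, inferInstance, inferInstance⟩
  have hk : IsCompact (Metric.closedBall (0 : K) 1) := by
    rw [← hball]
    exact isCompact_iff_compactSpace.2 hcomp
  have : LocallyCompactSpace K :=
    hk.locallyCompactSpace_of_mem_nhds_of_addGroup (Metric.closedBall_mem_nhds 0 zero_lt_one)
  exact .of_nontriviallyNormedField_of_weaklyLocallyCompactSpace K

/-- `ℙ^{d-1}(K)` is totally bounded. -/
theorem exists_finite_net (K : Type*) [NontriviallyNormedField K] [IsUltrametricDist K]
    [CompleteSpace K] [IsDiscreteValuationRing 𝒪[K]] [Finite 𝓀[K]] (d : ℕ) {ε : ℝ} (hε : 0 < ε) :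
    ∃ s : Set (ℙ K (Fin d → K)), s.Finite ∧ ∀ a, ∃ b ∈ s, projDist a b < ε := by
  have := properSpace K
  have htb : TotallyBounded (Metric.sphere (0 : Fin d → K) 1) :=
    (isCompact_sphere _ _).totallyBounded
  obtain ⟨t, htS, htf, hcov⟩ := Metric.finite_approx_of_totallyBounded htb ε hε
  have h0 : ∀ x ∈ t, x ≠ 0 := fun x hx h => by
    have := htS hx
    simp [h] at this
  have : Finite t := htf
  refine ⟨Set.range fun x : t => Projectivization.mk K x.1 (h0 _ x.2), Set.finite_range _,
    fun a => ?_⟩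
  have ha := (can_spec a).1
  have : can a ∈ Metric.sphere (0 : Fin d → K) 1 := by simpa using ha.2
  obtain ⟨y, hy, hd⟩ := Set.mem_iUnion₂.1 (hcov this)
  refine ⟨_, ⟨⟨y, hy⟩, rfl⟩, ?_⟩
  have hyr : IsReduced (Projectivization.mk K y (h0 y hy)) y :=
    ⟨⟨_, rfl⟩, by simpa using htS hy⟩
  refine (projDist_le ha hyr).trans_lt ?_
  simpa [dist_eq_norm] using hd

/-- `Ω` is compact. -/
instance (K : Type*) [NontriviallyNormedField K] [IsUltrametricDist K]
    [CompleteSpace K] [IsDiscreteValuationRing 𝒪[K]] [Finite 𝓀[K]] (d : ℕ) :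
    CompactSpace (Omega K d) := by
  have := properSpace K
  suffices h : IsCompact (Omega K d : Set (ℙ K (Fin d → K) →ᵤ (Fin d → K))) from
    isCompact_iff_compactSpace.1 h
  rw [isCompact_iff_ultrafilter_le_nhds]
  intro F hF
  have hF' : ∀ᶠ f in (F : Filter _), f ∈ Omega K d := Filter.le_principal_iff.1 hF
  have hlim : ∀ a, ∃ y ∈ Metric.closedBall (0 : Fin d → K) 1,
      Filter.Tendsto (fun f : ℙ K (Fin d → K) →ᵤ (Fin d → K) => UniformFun.toFun f a) F (nhds y) := by
    intro a
    have h := (isCompact_closedBall (0 : Fin d → K) 1).ultrafilter_le_nhds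
      (F.map fun f => UniformFun.toFun f a) (by
        rw [Filter.le_principal_iff]
        exact hF'.mono fun f hf => by simpa using hf.1 a)
    exact h
  choose g hg hgt using hlim
  have hgl : ∀ a b, ‖g a - g b‖ ≤ projDist a b := fun a b =>
    le_of_tendsto ((hgt a).sub (hgt b)).norm (hF'.mono fun f hf => hf.2 a b)
  refine ⟨UniformFun.ofFun g, ⟨fun a => by simpa using hg a, hgl⟩, ?_⟩
  have : Filter.Tendsto id (F : Filter (ℙ K (Fin d → K) →ᵤ (Fin d → K)))
      (nhds (UniformFun.ofFun g)) := by
    rw [UniformFun.tendsto_iff_tendstoUniformly, Metric.tendstoUniformly_iff]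
    intro ε hε
    obtain ⟨s, hs, hnet⟩ := exists_finite_net K d hε
    have hev : ∀ᶠ f in (F : Filter (ℙ K (Fin d → K) →ᵤ (Fin d → K))),
        ∀ b ∈ s, dist (UniformFun.toFun f b) (g b) < ε :=
      (Filter.eventually_all_finite hs).2 fun b _ => Metric.tendsto_nhds.1 (hgt b) ε hε
    filter_upwards [hev, hF'] with f h1 h2 a
    obtain ⟨b, hb, hab⟩ := hnet a
    have e1 : dist (g a) (g b) < ε := by
      rw [dist_eq_norm]; exact (hgl a b).trans_lt hab
    have e2 : dist (UniformFun.toFun f b) (UniformFun.toFun f a) < ε := by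
      rw [dist_comm, dist_eq_norm]; exact (h2.2 a b).trans_lt hab
    have e3 : dist (g b) (UniformFun.toFun f b) < ε := by rw [dist_comm]; exact h1 b hb
    calc dist (g a) (UniformFun.toFun f a)
        ≤ max (dist (g a) (g b)) (dist (g b) (UniformFun.toFun f a)) := dist_triangle_max _ _ _
      _ < ε := max_lt e1 ((dist_triangle_max _ _ _).trans_lt (max_lt e3 e2))
  exact this

/-- The Haar probability measure on the compact group `Ω`. -/
def haarOmega (K : Type*) [NontriviallyNormedField K] [IsUltrametricDist K]
    [CompleteSpace K] [IsDiscreteValuationRing 𝒪[K]] [Finite 𝓀[K]] (d : ℕ) :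
    Measure (Omega K d) :=
  Measure.addHaarMeasure (⊤ : TopologicalSpace.PositiveCompacts (Omega K d))

/-- The Haar measure on `K^d` normalized so that `R^d`, the closed unit ball, has measure one. -/
def haarSpace (K : Type*) [NontriviallyNormedField K] [IsUltrametricDist K]
    [CompleteSpace K] [IsDiscreteValuationRing 𝒪[K]] [Finite 𝓀[K]]
    [MeasurableSpace K] [BorelSpace K] (d : ℕ) : Measure (Fin d → K) :=
  haveI := properSpace K
  Measure.addHaarMeasure
    { carrier := Metric.closedBall (0 : Fin d → K) 1
      isCompact' := isCompact_closedBall _ _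
      interior_nonempty' :=
        ⟨0, Metric.ball_subset_interior_closedBall (Metric.mem_ball_self zero_lt_one)⟩ }

/-- The projective Kakeya set `N(f)`, the union over all the points `a` of the unit length
segments `{t • can a + f a | t ∈ R}`. -/
def kakeyaSet {K : Type*} [NontriviallyNormedField K] {d : ℕ}
    (f : ℙ K (Fin d → K) → Fin d → K) : Set (Fin d → K) :=
  ⋃ a : ℙ K (Fin d → K), {x | ∃ t : K, ‖t‖ ≤ 1 ∧ x = t • can a + f a}

/-- The `q^{-n}`-neighbourhood `N_n(f)` of `N(f)` in `R^d`. -/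
def kakeyaNhd {K : Type*} [NontriviallyNormedField K] [IsUltrametricDist K] {d : ℕ} (n : ℕ)
    (f : ℙ K (Fin d → K) → Fin d → K) : Set (Fin d → K) :=
  {x | ‖x‖ ≤ 1 ∧ Metric.infDist x (kakeyaSet f) ≤ ((residueCard K : ℝ)⁻¹) ^ n}

/-- The random variable `X_n`: the Haar measure of `N_n(f)`, for `f ∈ Ω`. -/
def X {K : Type*} [NontriviallyNormedField K] [IsUltrametricDist K]
    [CompleteSpace K] [IsDiscreteValuationRing 𝒪[K]] [Finite 𝓀[K]]
    [MeasurableSpace K] [BorelSpace K] {d : ℕ} (n : ℕ) (f : Omega K d) : ℝ :=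
  (haarSpace K d).real (kakeyaNhd n (UniformFun.toFun (f : ℙ K (Fin d → K) →ᵤ (Fin d → K))))

/-- The sequence `u_0 = 1`, `u_{n+1} = 1 - (1 - u_n / q^{d-1})^{q^{d-1}}`. -/
def u (q d : ℕ) : ℕ → ℝ
  | 0 => 1
  | n + 1 => 1 - (1 - u q d n / (q : ℝ) ^ (d - 1)) ^ (q ^ (d - 1))

end Kakeya

end

/-! For fixed `x` in `R^d`, translating `f` by the constant function `x` preserves Haar measure on
`Ω`, so `P(x ∈ N_n(f))` equals its value at `x = 0`. By Fubini, `E[X_n]` is the probability that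
`N(f)` meets the ball of radius `r ^ n` around `0`, where `r = q⁻¹`.

Whether the segment of direction `a` meets this ball depends only on the ball of radius `r ^ n`
containing `a` (`alive_congr_point`). The alive balls form a branching process. The root has `1 + q
+ ⋯ + q^(d-1)` children, and every later ball has `Q = q^(d-1)` (`card_node_one`, `card_children`).
A child of an alive ball survives with probability `q / q^d = 1/Q` (`card_norm_red_add_le`),
independently of the others, and a dead ball has no surviving child.

Independence comes from averaging over a finite family of translations `perturb n w`, which change
the `n`-th digits of `f` independently on each ball of radius `r ^ (n + 1)`. If `Z_n` is the number
of alive balls, this gives `E[(1 - v)^{Z_{n+1}}] = E[((1 - v/Q)^Q)^{Z_n}]` for `n ≥ 1`. The map `v ↦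
1 - (1 - v/Q)^Q` is the recursion defining `u`, so iterating from `v = u_0 = 1` computes the
extinction probability `P(Z_n = 0)`. -/

namespace Kakeya

/-! ### Ultrametric inequalities. -/

section Ultrametric

variable {E : Type*} [SeminormedAddCommGroup E] [IsUltrametricDist E] {x y : E} {c : ℝ}

theorem norm_add_le_of_le (hx : ‖x‖ ≤ c) (hy : ‖y‖ ≤ c) : ‖x + y‖ ≤ c :=
  (IsUltrametricDist.norm_add_le_max x y).trans (max_le hx hy)

theorem norm_sub_le_of_le (hx : ‖x‖ ≤ c) (hy : ‖y‖ ≤ c) : ‖x - y‖ ≤ c := by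
  rw [sub_eq_add_neg]
  exact norm_add_le_of_le hx (by rwa [norm_neg])

theorem norm_le_iff_of_norm_sub_le (h : ‖x - y‖ ≤ c) : ‖x‖ ≤ c ↔ ‖y‖ ≤ c := by
  refine ⟨fun hx => ?_, fun hy => ?_⟩
  · simpa using norm_sub_le_of_le hx h
  · simpa using norm_add_le_of_le h hy

theorem norm_eq_of_norm_sub_lt (h : ‖x - y‖ < ‖x‖) : ‖y‖ = ‖x‖ := by
  refine le_antisymm ?_ (le_of_not_gt fun hlt => ?_)
  · simpa using norm_sub_le_of_le le_rfl h.le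
  · have := IsUltrametricDist.norm_add_le_max (x - y) y
    rw [sub_add_cancel] at this
    exact absurd this (not_le.2 (max_lt h hlt))

end Ultrametric

/-! ### Canonical representatives and the projective distance. -/

section Projective

variable {K : Type*} [NontriviallyNormedField K] {d : ℕ}

/-- The index of the coordinate `1` of the canonical representative. -/
noncomputable def pivot (a : ℙ K (Fin d → K)) : Fin d := (can_spec a).2.choose

theorem can_pivot (a : ℙ K (Fin d → K)) : can a (pivot a) = 1 := (can_spec a).2.choose_spec.1

theorem norm_can_lt_one {a : ℙ K (Fin d → K)} {i : Fin d} (h : i < pivot a) : ‖can a i‖ < 1 :=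
  (can_spec a).2.choose_spec.2 i h

theorem norm_can (a : ℙ K (Fin d → K)) : ‖can a‖ = 1 := (can_spec a).1.2

theorem norm_can_apply_le (a : ℙ K (Fin d → K)) (i : Fin d) : ‖can a i‖ ≤ 1 :=
  (norm_le_pi_norm _ i).trans (norm_can a).le

theorem exists_can_eq {c : Fin d → K} {j : Fin d} (hc : ‖c‖ ≤ 1) (hj : c j = 1)
    (hlt : ∀ i < j, ‖c i‖ < 1) : ∃ a : ℙ K (Fin d → K), can a = c ∧ pivot a = j := by
  have hc0 : c ≠ 0 := fun h => by simp [h] at hj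
  have hc1 : ‖c‖ = 1 := le_antisymm hc (by simpa [hj] using norm_le_pi_norm c j)
  obtain ⟨a, hcan⟩ : ∃ a : ℙ K (Fin d → K), can a = c :=
    ⟨Projectivization.mk K c hc0, (existsUnique_isCanonical _).unique (can_spec _)
      ⟨⟨⟨hc0, rfl⟩, hc1⟩, j, hj, hlt⟩⟩
  refine ⟨a, hcan, ?_⟩
  rcases lt_trichotomy (pivot a) j with h | h | h
  · have := hlt _ h
    rw [← hcan, can_pivot, norm_one] at this
    exact absurd this (lt_irrefl _)
  · exact h
  · have := norm_can_lt_one h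
    rw [hcan, hj, norm_one] at this
    exact absurd this (lt_irrefl _)

theorem IsReduced.exists_eq_smul_can {a : ℙ K (Fin d → K)} {x : Fin d → K} (hx : IsReduced a x) :
    ∃ t : K, ‖t‖ = 1 ∧ x = t • can a := by
  obtain ⟨⟨hx0, hxa⟩, hx1⟩ := hx
  obtain ⟨hc0, hca⟩ := (can_spec a).1.1
  obtain ⟨t, ht⟩ := (Projectivization.mk_eq_mk_iff' K _ _ hx0 hc0).1 (hxa.trans hca.symm)
  refine ⟨t, ?_, ht.symm⟩
  rw [← ht, norm_smul, norm_can, mul_one] at hx1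
  exact hx1

variable [IsUltrametricDist K]

/-- If the pivots differed, then at the smaller one a coordinate of norm `1` would face one of norm
`< 1`, and the difference would have norm `1`. -/
theorem pivot_eq_of_norm_sub_smul_lt {a b : ℙ K (Fin d → K)} {t : K} (ht : ‖t‖ = 1)
    (h : ‖can a - t • can b‖ < 1) : pivot a = pivot b := by
  have hi : ∀ i, ‖can a i - t * can b i‖ < 1 := fun i =>
    (norm_le_pi_norm (can a - t • can b) i).trans_lt h
  rcases lt_trichotomy (pivot a) (pivot b) with hlt | heq | hlt
  · have h1 := hi (pivot a)
    rw [can_pivot] at h1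
    have h2 := norm_eq_of_norm_sub_lt (h1.trans_eq norm_one.symm)
    rw [norm_mul, ht, one_mul, norm_one] at h2
    exact absurd (norm_can_lt_one hlt) h2.not_lt
  · exact heq
  · have h1 := hi (pivot b)
    rw [can_pivot, mul_one, norm_sub_rev] at h1
    have h2 := norm_eq_of_norm_sub_lt (h1.trans_eq ht.symm)
    rw [ht] at h2
    exact absurd (norm_can_lt_one hlt) h2.not_lt

theorem pivot_eq_of_norm_sub_lt {a b : ℙ K (Fin d → K)} (h : ‖can a - can b‖ < 1) :
    pivot a = pivot b :=
  pivot_eq_of_norm_sub_smul_lt (t := 1) norm_one (by rwa [one_smul])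

theorem norm_can_sub_can_le_one (a b : ℙ K (Fin d → K)) : ‖can a - can b‖ ≤ 1 :=
  norm_sub_le_of_le (norm_can a).le (norm_can b).le

/-- With `projDist_le`, this shows that the infimum is attained at the canonical representatives.
After scaling by a unit, compare `can a` with `t • can b`: if they are closer than `1` the pivots
agree, and the pivot coordinate bounds `1 - t`, so `t` can be replaced by `1`. -/
theorem norm_can_sub_can_le_projDist (a b : ℙ K (Fin d → K)) :
    ‖can a - can b‖ ≤ projDist a b := by
  refine le_csInf ⟨_, _, _, (can_spec a).1, (can_spec b).1, rfl⟩ ?_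
  rintro _ ⟨x, y, hx, hy, rfl⟩
  obtain ⟨s, hs, rfl⟩ := hx.exists_eq_smul_can
  obtain ⟨t, ht, rfl⟩ := hy.exists_eq_smul_can
  have hs0 : s ≠ 0 := norm_ne_zero_iff.1 (by simp [hs])
  have e : s • can a - t • can b = s • (can a - (s⁻¹ * t) • can b) := by
    rw [smul_sub, smul_smul, mul_inv_cancel_left₀ hs0]
  rw [e, norm_smul, hs, one_mul]
  have ht' : ‖s⁻¹ * t‖ = 1 := by simp [hs, ht]
  generalize s⁻¹ * t = t at ht'
  rcases lt_or_ge ‖can a - t • can b‖ 1 with h | h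
  · have hp := pivot_eq_of_norm_sub_smul_lt ht' h
    have h1 : ‖1 - t‖ ≤ ‖can a - t • can b‖ := by
      have := norm_le_pi_norm (can a - t • can b) (pivot a)
      rw [Pi.sub_apply, Pi.smul_apply, can_pivot, hp, can_pivot] at this
      simpa using this
    have e : can a - can b = (can a - t • can b) - (1 - t) • can b := by
      rw [sub_smul, one_smul]; abel
    rw [e]
    exact norm_sub_le_of_le le_rfl (by rwa [norm_smul, norm_can, mul_one])
  · exact (norm_can_sub_can_le_one a b).trans h

theorem Omega.norm_apply_le (f : Omega K d) (a : ℙ K (Fin d → K)) :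
    ‖UniformFun.toFun f.1 a‖ ≤ 1 := f.2.1 a

theorem Omega.norm_sub_le (f : Omega K d) (a b : ℙ K (Fin d → K)) :
    ‖UniformFun.toFun f.1 a - UniformFun.toFun f.1 b‖ ≤ ‖can a - can b‖ :=
  (f.2.2 a b).trans (projDist_le (can_spec a).1 (can_spec b).1)

/-- The member of the universe `Ω` given by a function that is `1`-Lipschitz with respect to the
canonical representatives. -/
def Omega.mk (f : ℙ K (Fin d → K) → Fin d → K) (h1 : ∀ a, ‖f a‖ ≤ 1)
    (h2 : ∀ a b, ‖f a - f b‖ ≤ ‖can a - can b‖) : Omega K d :=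
  ⟨UniformFun.ofFun f, h1, fun a b => (h2 a b).trans (norm_can_sub_can_le_projDist a b)⟩

end Projective

/-! ### Digits: uniformizer and residue classes. -/

/-- A uniformizer of norm `r`, together with representatives of the residue classes of the unit
ball modulo this uniformizer, indexed by `κ`. -/
structure DigitSystem (K : Type*) [NontriviallyNormedField K] (r : ℝ) (κ : Type*) where
  unif : K
  norm_unif : ‖unif‖ = r
  r_pos : 0 < r
  r_lt_one : r < 1
  lift : κ → K
  norm_lift_le : ∀ k, ‖lift k‖ ≤ 1
  existsUnique_digit : ∀ x : K, ‖x‖ ≤ 1 → ∃! k, ‖x - lift k‖ ≤ r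
  norm_le_of_lt_one : ∀ x : K, ‖x‖ < 1 → ‖x‖ ≤ r

section Residue

theorem one_lt_residueCard (K : Type*) [NontriviallyNormedField K] [IsUltrametricDist K]
    [Finite 𝓀[K]] : 1 < residueCard K := Finite.one_lt_card

variable (K : Type*) [NontriviallyNormedField K] [IsUltrametricDist K]
    [IsDiscreteValuationRing 𝒪[K]] [Finite 𝓀[K]]

/-- Digits are lifts of residue classes. The hypothesis `hnorm` fixes the normalization `|x| =
q^(-val x)`, under which the maximal ideal is the ball of radius `q⁻¹`. -/
theorem exists_digitSystem
    (hnorm : ∀ ϖ : 𝒪[K], Irreducible ϖ → ‖(ϖ : K)‖ = (residueCard K : ℝ)⁻¹) :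
    Nonempty (DigitSystem K (residueCard K : ℝ)⁻¹ 𝓀[K]) := by
  obtain ⟨ϖ, hϖ⟩ := IsDiscreteValuationRing.exists_irreducible 𝒪[K]
  have hq : (1 : ℝ) < residueCard K := by exact_mod_cast one_lt_residueCard K
  have hr0 : (0 : ℝ) < (residueCard K : ℝ)⁻¹ := by positivity
  have hr1 : (residueCard K : ℝ)⁻¹ < 1 := inv_lt_one_of_one_lt₀ hq
  have hmem : ∀ x : 𝒪[K], x ∈ IsLocalRing.maximalIdeal 𝒪[K] ↔
      ‖(x : K)‖ ≤ (residueCard K : ℝ)⁻¹ := by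
    intro x
    constructor
    · intro hx
      rw [(IsDiscreteValuationRing.irreducible_iff_uniformizer ϖ).1 hϖ,
        Ideal.mem_span_singleton'] at hx
      obtain ⟨y, rfl⟩ := hx
      have hy : ‖(y : K)‖ ≤ 1 := Valued.integer.norm_le_one y
      rw [Subring.coe_mul, norm_mul, hnorm ϖ hϖ]
      exact mul_le_of_le_one_left hr0.le hy
    · intro hx
      rw [IsLocalRing.mem_maximalIdeal, mem_nonunits_iff, Valued.integer.isUnit_iff_norm_eq_one]
      exact (hx.trans_lt hr1).ne
  obtain ⟨σ, hσ⟩ := (IsLocalRing.residue_surjective (R := 𝒪[K])).hasRightInverse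
  have hres : ∀ x y : 𝒪[K], IsLocalRing.residue 𝒪[K] x = IsLocalRing.residue 𝒪[K] y ↔
      ‖(x : K) - y‖ ≤ (residueCard K : ℝ)⁻¹ := fun x y => by
    rw [← sub_eq_zero, ← map_sub, IsLocalRing.residue_eq_zero_iff, hmem]
    rfl
  refine ⟨⟨ϖ, hnorm ϖ hϖ, hr0, hr1, fun k => σ k, fun k => Valued.integer.norm_le_one _, ?_, ?_⟩⟩
  · intro x hx
    have hx' : x ∈ 𝒪[K] := by rw [Valued.integer.mem_iff]; simpa using hx
    refine ⟨IsLocalRing.residue 𝒪[K] ⟨x, hx'⟩, ?_, fun k hk => ?_⟩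
    · exact (hres ⟨x, hx'⟩ _).1 (hσ _).symm
    · rw [← hσ k]
      exact ((hres ⟨x, hx'⟩ _).2 hk).symm
  · intro x hx
    have hx' : x ∈ 𝒪[K] := by rw [Valued.integer.mem_iff]; simpa using hx.le
    refine (hmem ⟨x, hx'⟩).1 ?_
    rw [IsLocalRing.mem_maximalIdeal, mem_nonunits_iff, Valued.integer.isUnit_iff_norm_eq_one]
    exact hx.ne

end Residue

/-! ### The tree of balls of projective space. -/

section Node

variable {K : Type*} [NontriviallyNormedField K] [IsUltrametricDist K]

/-- Two points of `ℙ^{d-1}(K)` are equivalent when their distance is at most `c`. -/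
def nodeSetoid (K : Type*) [NontriviallyNormedField K] [IsUltrametricDist K] (d : ℕ) {c : ℝ}
    (hc : 0 ≤ c) : Setoid (ℙ K (Fin d → K)) where
  r a b := ‖can a - can b‖ ≤ c
  iseqv :=
    { refl := fun a => by simpa using hc
      symm := fun h => by rwa [norm_sub_rev]
      trans := fun {a b e} h h' => by simpa using norm_add_le_of_le h h' }

/-- The set of the balls of radius `c` of `ℙ^{d-1}(K)`. -/
abbrev Node (K : Type*) [NontriviallyNormedField K] [IsUltrametricDist K] (d : ℕ) {c : ℝ}
    (hc : 0 ≤ c) : Type _ :=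
  Quotient (nodeSetoid K d hc)

variable {d : ℕ} {c c' : ℝ} {hc : 0 ≤ c} {hc' : 0 ≤ c'}

/-- The ball of radius `c` that contains a point. -/
def node (hc : 0 ≤ c) (a : ℙ K (Fin d → K)) : Node K d hc := Quotient.mk _ a

theorem node_eq_node {a b : ℙ K (Fin d → K)} :
    node hc a = node hc b ↔ ‖can a - can b‖ ≤ c := Quotient.eq (r := nodeSetoid K d hc)

theorem node_out (b : Node K d hc) : node hc b.out = b := Quotient.out_eq b

theorem norm_can_out_sub_le (a : ℙ K (Fin d → K)) :
    ‖can (node hc a).out - can a‖ ≤ c := node_eq_node.1 (node_out (node hc a))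

theorem finite_node [CompleteSpace K] [IsDiscreteValuationRing 𝒪[K]] [Finite 𝓀[K]]
    (hc : 0 < c) : Finite (Node K d hc.le) := by
  obtain ⟨s, hs, h⟩ := exists_finite_net K d hc
  have : Finite s := hs
  refine Finite.of_surjective (fun a : s => node hc.le a.1) fun b => ?_
  obtain ⟨a, ha, hlt⟩ := h b.out
  refine ⟨⟨a, ha⟩, ?_⟩
  rw [← node_out b, node_eq_node, norm_sub_rev]
  exact (norm_can_sub_can_le_projDist _ _).trans hlt.le

end Node

namespace DigitSystem

variable {K : Type*} [NontriviallyNormedField K] {r : ℝ} {κ : Type*} {d : ℕ}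

section Basic

variable (D : DigitSystem K r κ)

theorem unif_ne_zero : D.unif ≠ 0 := norm_pos_iff.1 (D.r_pos.trans_eq D.norm_unif.symm)

theorem pow_nonneg (D : DigitSystem K r κ) (n : ℕ) : 0 ≤ r ^ n := (pow_pos D.r_pos n).le

theorem norm_unif_pow (n : ℕ) : ‖D.unif ^ n‖ = r ^ n := by rw [norm_pow, D.norm_unif]

theorem norm_unif_pow_smul_le_iff (n : ℕ) {x : Fin d → K} {c : ℝ} :
    ‖D.unif ^ n • x‖ ≤ r ^ n * c ↔ ‖x‖ ≤ c := by
  rw [norm_smul, D.norm_unif_pow]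
  exact mul_le_mul_iff_right₀ (pow_pos D.r_pos n)

theorem norm_le_of_lt_one' (D : DigitSystem K r κ) {x : Fin d → K} (h : ‖x‖ < 1) : ‖x‖ ≤ r :=
  (pi_norm_le_iff_of_nonneg D.r_pos.le).2 fun i =>
    D.norm_le_of_lt_one _ ((norm_le_pi_norm x i).trans_lt h)

theorem exists_eq_unif_pow_smul (n : ℕ) (x : Fin d → K) :
    ∃ y : Fin d → K, x = D.unif ^ n • y :=
  ⟨(D.unif ^ n)⁻¹ • x, by rw [smul_inv_smul₀ (pow_ne_zero n D.unif_ne_zero)]⟩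

/-- Discreteness of the norm, rescaled by `unif ^ n`. -/
theorem norm_le_pow_succ_of_lt_pow (D : DigitSystem K r κ) {n : ℕ} {x : Fin d → K} (h : ‖x‖ < r ^ n) :
    ‖x‖ ≤ r ^ (n + 1) := by
  obtain ⟨y, rfl⟩ := D.exists_eq_unif_pow_smul n x
  rw [pow_succ, D.norm_unif_pow_smul_le_iff]
  refine D.norm_le_of_lt_one' ?_
  rw [norm_smul, D.norm_unif_pow] at h
  exact (mul_lt_iff_lt_one_right (pow_pos D.r_pos n)).1 h

/-- The index of the residue class of an element of the unit ball. -/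
noncomputable def digit (x : K) (hx : ‖x‖ ≤ 1) : κ := (D.existsUnique_digit x hx).choose

theorem norm_sub_lift_digit_le (x : K) (hx : ‖x‖ ≤ 1) : ‖x - D.lift (D.digit x hx)‖ ≤ r :=
  (D.existsUnique_digit x hx).choose_spec.1

theorem eq_of_norm_lift_sub_le {k l : κ} (h : ‖D.lift k - D.lift l‖ ≤ r) : k = l :=
  (D.existsUnique_digit _ (D.norm_lift_le k)).unique (by simpa using D.r_pos.le) h

end Basic

variable [IsUltrametricDist K] (D : DigitSystem K r κ)

/-- The ball of radius `r ^ n` that contains a point. -/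
abbrev nodeAt (n : ℕ) (a : ℙ K (Fin d → K)) : Node K d (D.pow_nonneg n) := node _ a

/-- A canonical representative is determined up to `r` by the pivot and the following digits. -/
theorem card_node_one [Finite κ] :
    Nat.card (Node K d (D.pow_nonneg 1)) = ∑ i ∈ Finset.range d, Nat.card κ ^ i := by
  classical
  -- Pivot `p.1`: zeros before it, free digits after it.
  let c : (Σ j : Fin d, {i : Fin d // j < i} → κ) → Fin d → K := fun p i =>
    if h : p.1 < i then D.lift (p.2 ⟨i, h⟩) else if i = p.1 then 1 else 0
  have hcj : ∀ p, c p p.1 = 1 := fun p => by simp [c]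
  have hcl : ∀ p, ∀ i < p.1, c p i = 0 := fun p i h => by simp [c, h.not_gt, h.ne]
  have hcg : ∀ p i (h : p.1 < i), c p i = D.lift (p.2 ⟨i, h⟩) := fun p i h => by simp [c, h]
  have hc1 : ∀ p, ‖c p‖ ≤ 1 := fun p => by
    refine (pi_norm_le_iff_of_nonneg zero_le_one).2 fun i => ?_
    rcases lt_trichotomy i p.1 with h | rfl | h
    · simp [hcl p i h]
    · simp [hcj]
    · rw [hcg p i h]; exact D.norm_lift_le _
  have hex : ∀ p, ∃ a : ℙ K (Fin d → K), can a = c p ∧ pivot a = p.1 := fun p =>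
    exists_can_eq (hc1 p) (hcj p) fun i h => by simp [hcl p i h]
  choose A hA hAp using hex
  have hbij : Function.Bijective fun p => D.nodeAt 1 (A p) := by
    constructor
    · intro p p' h
      have h' := node_eq_node.1 h
      rw [pow_one] at h'
      have hp := pivot_eq_of_norm_sub_lt (h'.trans_lt D.r_lt_one)
      rw [hAp, hAp] at hp
      rw [hA, hA] at h'
      obtain ⟨j, k⟩ := p
      obtain ⟨j', k'⟩ := p'
      obtain rfl : j = j' := hp
      congr 1
      funext i
      refine D.eq_of_norm_lift_sub_le ?_
      have := (norm_le_pi_norm _ i.1).trans h'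
      rwa [Pi.sub_apply, hcg _ i.1 i.2, hcg _ i.1 i.2] at this
    · intro b
      refine ⟨⟨pivot b.out, fun i => D.digit (can b.out i.1) (norm_can_apply_le _ _)⟩,
        Eq.trans (node_eq_node.2 ?_) (node_out b)⟩
      rw [norm_sub_rev, hA]
      refine le_of_le_of_eq ?_ (pow_one r).symm
      refine (pi_norm_le_iff_of_nonneg D.r_pos.le).2 fun i => ?_
      rw [Pi.sub_apply]
      -- Before the pivot the norm is `< 1`, hence `≤ r`, so `0` is a correct approximation there.
      rcases lt_trichotomy i (pivot b.out) with h | h | h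
      · rw [hcl _ i h, sub_zero]
        exact D.norm_le_of_lt_one _ (norm_can_lt_one h)
      · rw [h, can_pivot, hcj, sub_self, norm_zero]
        exact D.r_pos.le
      · rw [hcg _ i h]
        exact D.norm_sub_lift_digit_le _ (norm_can_apply_le _ _)
  rw [← Nat.card_congr (Equiv.ofBijective _ hbij), Nat.card_sigma]
  have : ∀ j : Fin d, Nat.card ({i : Fin d // j < i} → κ) = Nat.card κ ^ (d - 1 - j) := by
    intro j
    rw [Nat.card_fun, Nat.card_eq_fintype_card (α := {i // j < i}), Fintype.card_subtype,
      ← Fin.card_Ioi j]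
    congr 2
    ext; simp
  rw [Finset.sum_congr rfl fun j _ => this j, Finset.sum_range, ← Equiv.sum_comp Fin.revPerm]
  refine Finset.sum_congr rfl fun j _ => ?_
  congr 1
  simp only [Fin.revPerm_apply, Fin.val_rev]
  omega

/-- A ball of radius `r ^ n`, with `n ≥ 1`, is the union of `q ^ (d - 1)` balls of radius
`r ^ (n + 1)`. -/
theorem card_children [Finite κ] {n : ℕ} (hn : n ≠ 0) (b : Node K d (D.pow_nonneg n)) :
    Nat.card {b' : Node K d (D.pow_nonneg (n + 1)) // D.nodeAt n b'.out = b}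
      = Nat.card κ ^ (d - 1) := by
  classical
  set a := b.out with ha
  set j := pivot a with hj
  -- This is where `n ≠ 0` matters: within a ball of radius `< 1` all points share one pivot, so
  -- only the other `d - 1` coordinates vary.
  have hrn : r ^ n < 1 := pow_lt_one₀ D.r_pos.le D.r_lt_one hn
  have hle : r ^ (n + 1) ≤ r ^ n := pow_le_pow_of_le_one D.r_pos.le D.r_lt_one.le n.le_succ
  let v : ({i : Fin d // i ≠ j} → κ) → Fin d → K := fun k i =>
    if h : i = j then 0 else D.lift (k ⟨i, h⟩)
  have hvj : ∀ k, v k j = 0 := fun k => by simp [v]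
  have hvi : ∀ k i (h : i ≠ j), v k i = D.lift (k ⟨i, h⟩) := fun k i h => by simp [v, h]
  have hv : ∀ k, ‖v k‖ ≤ 1 := fun k => by
    refine (pi_norm_le_iff_of_nonneg zero_le_one).2 fun i => ?_
    by_cases h : i = j
    · simp [h, hvj]
    · rw [hvi k i h]; exact D.norm_lift_le _
  have hs : ∀ k, ‖D.unif ^ n • v k‖ ≤ r ^ n := fun k => by
    rw [← mul_one (r ^ n), D.norm_unif_pow_smul_le_iff]; exact hv k
  have hex : ∀ k, ∃ e : ℙ K (Fin d → K), can e = can a + D.unif ^ n • v k ∧ pivot e = j := by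
    intro k
    refine exists_can_eq (norm_add_le_of_le (norm_can a).le ((hs k).trans hrn.le)) ?_ ?_
    · rw [Pi.add_apply, Pi.smul_apply, hvj, hj, can_pivot, smul_zero, add_zero]
    · intro i hi
      exact (IsUltrametricDist.norm_add_le_max _ _).trans_lt
        (max_lt (norm_can_lt_one hi) (((norm_le_pi_norm _ i).trans (hs k)).trans_lt hrn))
  choose A hA hAp using hex
  have hmem : ∀ k, D.nodeAt n (D.nodeAt (n + 1) (A k)).out = b := fun k => by
    rw [← node_out b, node_eq_node, ← ha]
    have h1 := (norm_can_out_sub_le (hc := D.pow_nonneg (n + 1)) (A k)).trans hle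
    have h2 : ‖can (A k) - can a‖ ≤ r ^ n := by
      rw [hA, add_sub_cancel_left]; exact hs k
    simpa using norm_add_le_of_le h1 h2
  have hbij : Function.Bijective fun k =>
      (⟨D.nodeAt (n + 1) (A k), hmem k⟩ :
        {b' : Node K d (D.pow_nonneg (n + 1)) // D.nodeAt n b'.out = b}) := by
    constructor
    · intro k k' h
      have h' := node_eq_node.1 (Subtype.ext_iff.1 h)
      rw [hA, hA, add_sub_add_left_eq_sub, ← smul_sub, pow_succ,
        D.norm_unif_pow_smul_le_iff] at h'
      funext i
      refine D.eq_of_norm_lift_sub_le ?_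
      have := (norm_le_pi_norm _ i.1).trans h'
      rwa [Pi.sub_apply, hvi _ i.1 i.2, hvi _ i.1 i.2] at this
    · rintro ⟨b', hb'⟩
      have hd : ‖can b'.out - can a‖ ≤ r ^ n := by
        rwa [← node_out b, node_eq_node] at hb'
      obtain ⟨y, hy⟩ := D.exists_eq_unif_pow_smul n (can b'.out - can a)
      have hy1 : ‖y‖ ≤ 1 := by
        rwa [hy, ← mul_one (r ^ n), D.norm_unif_pow_smul_le_iff] at hd
      have hpiv : pivot b'.out = j := pivot_eq_of_norm_sub_lt (hd.trans_lt hrn)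
      have hyj : y j = 0 := by
        have := congrFun hy j
        rw [Pi.sub_apply, ← hpiv, can_pivot, hpiv, hj, can_pivot, sub_self, Pi.smul_apply,
          smul_eq_mul, eq_comm, mul_eq_zero] at this
        exact this.resolve_left (pow_ne_zero n D.unif_ne_zero)
      obtain ⟨k, hk⟩ : ∃ k : {i : Fin d // i ≠ j} → κ, ∀ i, ‖y i.1 - D.lift (k i)‖ ≤ r :=
        ⟨fun i => D.digit (y i.1) ((norm_le_pi_norm y _).trans hy1),
          fun i => D.norm_sub_lift_digit_le _ _⟩
      refine ⟨k, Subtype.ext (Eq.trans (node_eq_node.2 ?_) (node_out b'))⟩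
      rw [norm_sub_rev, hA, ← sub_sub, hy, ← smul_sub, pow_succ,
        D.norm_unif_pow_smul_le_iff]
      refine (pi_norm_le_iff_of_nonneg D.r_pos.le).2 fun i => ?_
      rw [Pi.sub_apply]
      by_cases h : i = j
      · rw [h, hvj, hyj, sub_zero, norm_zero]; exact D.r_pos.le
      · rw [hvi _ i h]; exact hk ⟨i, h⟩
  rw [← Nat.card_congr (Equiv.ofBijective _ hbij), Nat.card_fun,
    Nat.card_eq_fintype_card (α := {i // i ≠ j}), Fintype.card_subtype_compl, Fintype.card_subtype_eq, Fintype.card_fin]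

end DigitSystem

/-! ### Projection along a line, and lines passing near the origin. -/

section Red

variable {K : Type*} [NontriviallyNormedField K] {d : ℕ}

/-- The projection of a vector, along the line `a`, to the hyperplane where the pivot coordinate
vanishes. -/
noncomputable def red (a : ℙ K (Fin d → K)) (v : Fin d → K) : Fin d → K := v - v (pivot a) • can a

theorem red_add (a : ℙ K (Fin d → K)) (v w : Fin d → K) : red a (v + w) = red a v + red a w := by
  simp only [red, Pi.add_apply, add_smul]; abel

theorem red_sub (a : ℙ K (Fin d → K)) (v w : Fin d → K) : red a (v - w) = red a v - red a w := by
  simp only [red, Pi.sub_apply, sub_smul]; abel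

theorem red_smul (a : ℙ K (Fin d → K)) (t : K) (v : Fin d → K) : red a (t • v) = t • red a v := by
  simp only [red, Pi.smul_apply, smul_sub, smul_smul, smul_eq_mul]

theorem red_can (a : ℙ K (Fin d → K)) : red a (can a) = 0 := by simp [red, can_pivot]

theorem red_pivot (a : ℙ K (Fin d → K)) (v : Fin d → K) : red a v (pivot a) = 0 := by
  simp [red, can_pivot]

variable [IsUltrametricDist K]

theorem norm_red_le (a : ℙ K (Fin d → K)) {v : Fin d → K} {c : ℝ} (h : ‖v‖ ≤ c) :
    ‖red a v‖ ≤ c :=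
  norm_sub_le_of_le h (by rw [norm_smul, norm_can, mul_one]; exact (norm_le_pi_norm v _).trans h)

/-- The line directed by `a` through `f a` passes at distance at most `c` from the origin. -/
def Alive (c : ℝ) (f : Omega K d) (a : ℙ K (Fin d → K)) : Prop :=
  ‖red a (UniformFun.toFun f.1 a)‖ ≤ c

theorem alive_of_one_le {c : ℝ} (hc : 1 ≤ c) (f : Omega K d) (a : ℙ K (Fin d → K)) :
    Alive c f a :=
  norm_red_le a ((Omega.norm_apply_le f a).trans hc)

/-- The projection kills `can a` and does not increase norms, so the best `t` is the one cancelling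
the pivot coordinate of `f a`; it is in `R` because `f a` is in `R^d`. -/
theorem alive_iff_exists {c : ℝ} (f : Omega K d) (a : ℙ K (Fin d → K)) :
    Alive c f a ↔ ∃ t : K, ‖t‖ ≤ 1 ∧ ‖t • can a + UniformFun.toFun f.1 a‖ ≤ c := by
  constructor
  · intro h
    refine ⟨-UniformFun.toFun f.1 a (pivot a), ?_, ?_⟩
    · rw [norm_neg]
      exact (norm_le_pi_norm _ _).trans (Omega.norm_apply_le f a)
    · rw [neg_smul, neg_add_eq_sub]
      exact h
  · rintro ⟨t, -, h⟩
    have := norm_red_le a h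
    rwa [red_add, red_smul, red_can, smul_zero, zero_add] at this

/-- For `c < 1` the pivots agree, and both sources of variation, the Lipschitz function `f` and the
direction `can a`, contribute at most `c`. -/
theorem alive_congr_point {c : ℝ} (f : Omega K d) {a b : ℙ K (Fin d → K)}
    (h : ‖can a - can b‖ ≤ c) : Alive c f a ↔ Alive c f b := by
  rcases le_or_gt 1 c with hc | hc
  · exact iff_of_true (alive_of_one_le hc f a) (alive_of_one_le hc f b)
  refine norm_le_iff_of_norm_sub_le ?_
  have hp : pivot a = pivot b := pivot_eq_of_norm_sub_lt (h.trans_lt hc)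
  set v := UniformFun.toFun f.1 a
  set w := UniformFun.toFun f.1 b
  have e : red a v - red b w = red a (v - w) - w (pivot b) • (can a - can b) := by
    simp only [red, hp, Pi.sub_apply, sub_smul, smul_sub]; abel
  rw [e]
  refine norm_sub_le_of_le (norm_red_le a ((Omega.norm_sub_le f a b).trans h)) ?_
  rw [norm_smul]
  exact (mul_le_of_le_one_left (norm_nonneg _)
    ((norm_le_pi_norm w _).trans (Omega.norm_apply_le f b))).trans h

theorem alive_congr_fun {c : ℝ} {f g : Omega K d} (a : ℙ K (Fin d → K))
    (h : ‖UniformFun.toFun f.1 a - UniformFun.toFun g.1 a‖ ≤ c) : Alive c f a ↔ Alive c g a := by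
  refine norm_le_iff_of_norm_sub_le ?_
  rw [← red_sub]
  exact norm_red_le a h

end Red

/-! ### Survival of a ball under a random digit. -/

namespace DigitSystem

variable {K : Type*} [NontriviallyNormedField K] {r : ℝ} {κ : Type*} {d : ℕ}
  (D : DigitSystem K r κ)

theorem pow_succ_le (D : DigitSystem K r κ) (n : ℕ) : r ^ (n + 1) ≤ r ^ n :=
  pow_le_pow_of_le_one D.r_pos.le D.r_lt_one.le n.le_succ

/-- The vector of the unit ball with given digits. -/
def liftVec (k : Fin d → κ) : Fin d → K := fun i => D.lift (k i)

theorem norm_liftVec_le (k : Fin d → κ) : ‖D.liftVec k‖ ≤ 1 :=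
  (pi_norm_le_iff_of_nonneg zero_le_one).2 fun _ => D.norm_lift_le _

theorem norm_unif_pow_smul_liftVec_le (n : ℕ) (k : Fin d → κ) :
    ‖D.unif ^ n • D.liftVec k‖ ≤ r ^ n := by
  rw [← mul_one (r ^ n), D.norm_unif_pow_smul_le_iff]
  exact D.norm_liftVec_le k

variable [IsUltrametricDist K]

/-- Dead balls have no surviving children. -/
theorem norm_red_le_of_norm_red_add_le {n : ℕ} {a : ℙ K (Fin d → K)} {v : Fin d → K}
    {k : Fin d → κ} (h : ‖red a (v + D.unif ^ n • D.liftVec k)‖ ≤ r ^ (n + 1)) :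
    ‖red a v‖ ≤ r ^ n := by
  refine (norm_le_iff_of_norm_sub_le ?_).1 (h.trans (D.pow_succ_le n))
  rw [← red_sub, add_sub_cancel_left]
  exact norm_red_le a (D.norm_unif_pow_smul_liftVec_le n k)

/-- The survival probability `q / q^d`: the pivot digit of `k` is free, and it forces every other
digit. -/
theorem card_norm_red_add_le {n : ℕ} {a : ℙ K (Fin d → K)} {v : Fin d → K}
    (h : ‖red a v‖ ≤ r ^ n) :
    Nat.card {k : Fin d → κ // ‖red a (v + D.unif ^ n • D.liftVec k)‖ ≤ r ^ (n + 1)}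
      = Nat.card κ := by
  classical
  obtain ⟨y, hy⟩ := D.exists_eq_unif_pow_smul n (red a v)
  have hy1 : ‖y‖ ≤ 1 := by
    rwa [hy, ← mul_one (r ^ n), D.norm_unif_pow_smul_le_iff] at h
  have hyp : y (pivot a) = 0 := by
    have := congrFun hy (pivot a)
    rw [red_pivot, Pi.smul_apply, smul_eq_mul, eq_comm, mul_eq_zero] at this
    exact this.resolve_left (pow_ne_zero n D.unif_ne_zero)
  have hiff : ∀ k : Fin d → κ, ‖red a (v + D.unif ^ n • D.liftVec k)‖ ≤ r ^ (n + 1) ↔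
      ∀ i ≠ pivot a, ‖D.lift (k (pivot a)) * can a i - y i - D.lift (k i)‖ ≤ r := by
    intro k
    rw [red_add, red_smul, hy, ← smul_add, pow_succ, D.norm_unif_pow_smul_le_iff,
      pi_norm_le_iff_of_nonneg D.r_pos.le]
    have e : ∀ i, ‖(y + red a (D.liftVec k)) i‖
        = ‖D.lift (k (pivot a)) * can a i - y i - D.lift (k i)‖ := fun i => by
      rw [← norm_neg]
      congr 1
      simp only [red, liftVec, Pi.add_apply, Pi.sub_apply, Pi.smul_apply, smul_eq_mul]
      ring
    refine ⟨fun H i _ => (e i).symm.trans_le (H i), fun H i => ?_⟩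
    by_cases hi : i = pivot a
    · rw [hi, Pi.add_apply, red_pivot, hyp, add_zero, norm_zero]
      exact D.r_pos.le
    · exact (e i).trans_le (H i hi)
  have hn : ∀ (l : κ) (i : Fin d), ‖D.lift l * can a i - y i‖ ≤ 1 := fun l i => by
    refine norm_sub_le_of_le ?_ ((norm_le_pi_norm y i).trans hy1)
    rw [norm_mul]
    exact mul_le_one₀ (D.norm_lift_le l) (norm_nonneg _) (norm_can_apply_le a i)
  refine Nat.card_congr (Equiv.ofBijective (fun k => k.1 (pivot a)) ⟨?_, fun l => ?_⟩)
  · rintro ⟨k, hk⟩ ⟨k', hk'⟩ hkk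
    refine Subtype.ext (funext fun i => ?_)
    change k (pivot a) = k' (pivot a) at hkk
    by_cases hi : i = pivot a
    · rw [hi]; exact hkk
    · have h1 := (hiff k).1 hk i hi
      have h2 := (hiff k').1 hk' i hi
      rw [← hkk] at h2
      exact (D.existsUnique_digit _ (hn _ i)).unique h1 h2
  · refine ⟨⟨fun i => if i = pivot a then l else D.digit _ (hn l i), (hiff _).2 fun i hi => ?_⟩, ?_⟩
    · simp only [if_true, if_neg hi]
      exact D.norm_sub_lift_digit_le _ (hn l i)
    · simp

/-- The perturbation of level `n`, constant on the balls of radius `r ^ (n + 1)`, with given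
digits. -/
def perturb (n : ℕ) (w : Node K d (D.pow_nonneg (n + 1)) → Fin d → κ) : Omega K d :=
  Omega.mk (fun a => D.unif ^ n • D.liftVec (w (D.nodeAt (n + 1) a)))
    (fun a => (D.norm_unif_pow_smul_liftVec_le n _).trans
      (pow_le_one₀ D.r_pos.le D.r_lt_one.le))
    (fun a b => by
      by_cases h : D.nodeAt (n + 1) a = D.nodeAt (n + 1) b
      · rw [h, sub_self, norm_zero]
        exact norm_nonneg _
      -- Points in distinct balls of radius `r ^ (n + 1)` are at distance at least `r ^ n`, which
      -- bounds the perturbation.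
      · refine (norm_sub_le_of_le (D.norm_unif_pow_smul_liftVec_le n _)
          (D.norm_unif_pow_smul_liftVec_le n _)).trans (le_of_not_gt fun hlt => h ?_)
        exact node_eq_node.2 (D.norm_le_pow_succ_of_lt_pow hlt))

/-- Only the digit vector `w b` matters at the ball `b`; this is the independence of the children.
-/
theorem alive_add_perturb {n m : ℕ} (w : Node K d (D.pow_nonneg (n + 1)) → Fin d → κ)
    (f : Omega K d) (b : Node K d (D.pow_nonneg (n + 1))) :
    Alive (r ^ m) (f + D.perturb n w) b.out ↔
      ‖red b.out (UniformFun.toFun f.1 b.out + D.unif ^ n • D.liftVec (w b))‖ ≤ r ^ m := by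
  change ‖red b.out (UniformFun.toFun f.1 b.out +
    D.unif ^ n • D.liftVec (w (D.nodeAt (n + 1) b.out)))‖ ≤ r ^ m ↔ _
  rw [show D.nodeAt (n + 1) b.out = b from node_out b]

/-! ### Generating function of the number of alive balls. -/

section Generating

variable [∀ n, Fintype (Node K d (D.pow_nonneg n))]

open Classical in
/-- The product over the balls of radius `r ^ n` of `s` for those where `f` is alive; as a function
of `s`, its expectation is the generating function of the number of these balls. -/
noncomputable def gen (n : ℕ) (s : ℝ) (f : Omega K d) : ℝ :=
  ∏ b : Node K d (D.pow_nonneg n), if Alive (r ^ n) f b.out then s else 1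

/-- At `s = 0` the generating function detects extinction. -/
theorem gen_zero (n : ℕ) (f : Omega K d) [Decidable (∃ a, Alive (r ^ n) f a)] :
    D.gen n 0 f = if ∃ a, Alive (r ^ n) f a then 0 else 1 := by
  classical
  unfold gen
  split_ifs with h
  · obtain ⟨a, ha⟩ := h
    refine Finset.prod_eq_zero (Finset.mem_univ (D.nodeAt n a)) (if_pos ?_)
    exact (alive_congr_point f (norm_can_out_sub_le a)).2 ha
  · push Not at h
    simp [h]

theorem gen_congr {n : ℕ} (s : ℝ) {f g : Omega K d}
    (h : ∀ a, ‖UniformFun.toFun f.1 a - UniformFun.toFun g.1 a‖ ≤ r ^ n) :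
    D.gen n s f = D.gen n s g := by
  classical
  exact Finset.prod_congr rfl fun b _ => if_congr (alive_congr_fun _ (h _)) rfl rfl

variable [Fintype κ]

open Classical in
-- Since `w` ranges over a product, the sum of products is a product of sums over single digit
-- vectors. Each factor is a mean: `1 - v` with probability `q^(1-d)` if the line is alive at level
-- `n`, and `1` otherwise.
theorem sum_gen_add_perturb (hd : 1 ≤ d) (n : ℕ) (v : ℝ) (f : Omega K d) :
    ∑ w : Node K d (D.pow_nonneg (n + 1)) → Fin d → κ, D.gen (n + 1) (1 - v) (f + D.perturb n w)
      = (Fintype.card (Node K d (D.pow_nonneg (n + 1)) → Fin d → κ) : ℝ) *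
        ∏ b : Node K d (D.pow_nonneg (n + 1)),
          if Alive (r ^ n) f b.out then 1 - v / (Fintype.card κ : ℝ) ^ (d - 1) else 1 := by
  have hκ : 0 < Fintype.card κ :=
    Fintype.card_pos_iff.2 ⟨(D.existsUnique_digit 0 (by simp)).choose⟩
  have hq : (Fintype.card κ : ℝ) ≠ 0 := by exact_mod_cast hκ.ne'
  have hsum : ∀ b : Node K d (D.pow_nonneg (n + 1)),
      ∑ k : Fin d → κ,
        (if ‖red b.out (UniformFun.toFun f.1 b.out + D.unif ^ n • D.liftVec k)‖ ≤ r ^ (n + 1)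
          then 1 - v else 1)
      = (Fintype.card κ : ℝ) ^ d *
        (if Alive (r ^ n) f b.out then 1 - v / (Fintype.card κ : ℝ) ^ (d - 1) else 1) := by
    intro b
    have e : ∀ k : Fin d → κ,
        (if ‖red b.out (UniformFun.toFun f.1 b.out + D.unif ^ n • D.liftVec k)‖ ≤ r ^ (n + 1)
          then 1 - v else 1) = 1 - v *
        (if ‖red b.out (UniformFun.toFun f.1 b.out + D.unif ^ n • D.liftVec k)‖ ≤ r ^ (n + 1)
          then 1 else 0) := fun k => by split_ifs <;> ring
    rw [Finset.sum_congr rfl fun k _ => e k, Finset.sum_sub_distrib, ← Finset.mul_sum,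
      Finset.sum_boole, ← Fintype.card_subtype, ← Nat.card_eq_fintype_card]
    simp only [Finset.sum_const, Finset.card_univ, Fintype.card_fun, Fintype.card_fin,
      nsmul_eq_mul, mul_one, Nat.cast_pow]
    split_ifs with h
    · rw [D.card_norm_red_add_le h, Nat.card_eq_fintype_card, mul_sub, mul_one]
      obtain ⟨m, rfl⟩ : ∃ m, d = m + 1 := ⟨d - 1, by omega⟩
      rw [Nat.add_sub_cancel, pow_succ]
      field_simp
    · rw [Nat.card_eq_zero.2 (Or.inl ⟨fun k => h (D.norm_red_le_of_norm_red_add_le k.2)⟩)]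
      simp
  simp only [gen, D.alive_add_perturb]
  have key := Finset.prod_univ_sum (fun _ : Node K d (D.pow_nonneg (n + 1)) =>
    (Finset.univ : Finset (Fin d → κ))) (fun b k =>
      if ‖red b.out (UniformFun.toFun f.1 b.out + D.unif ^ n • D.liftVec k)‖ ≤ r ^ (n + 1)
        then 1 - v else 1)
  rw [Fintype.piFinset_univ] at key
  rw [← key, Finset.prod_congr rfl fun b _ => hsum b, Finset.prod_mul_distrib]
  simp

open Classical in
-- Grouping the balls by parent, the `q^(d-1)` children of one parent contribute equal factors,
-- since aliveness at scale `r ^ n` is read on the parent.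
theorem sum_gen_add_perturb_succ (hd : 1 ≤ d) {n : ℕ} (hn : n ≠ 0) (v : ℝ) (f : Omega K d) :
    ∑ w : Node K d (D.pow_nonneg (n + 1)) → Fin d → κ, D.gen (n + 1) (1 - v) (f + D.perturb n w)
      = (Fintype.card (Node K d (D.pow_nonneg (n + 1)) → Fin d → κ) : ℝ) *
        D.gen n ((1 - v / (Fintype.card κ : ℝ) ^ (d - 1)) ^ (Fintype.card κ ^ (d - 1))) f := by
  classical
  rw [D.sum_gen_add_perturb hd, gen]
  congr 1
  rw [← Finset.prod_fiberwise Finset.univ fun b : Node K d (D.pow_nonneg (n + 1)) =>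
    D.nodeAt n b.out]
  refine Finset.prod_congr rfl fun b _ => ?_
  have e : ∀ b' : Node K d (D.pow_nonneg (n + 1)), D.nodeAt n b'.out = b →
      (Alive (r ^ n) f b'.out ↔ Alive (r ^ n) f b.out) := fun b' h =>
    alive_congr_point f (node_eq_node.1 (h.trans (node_out b).symm))
  have hc : (Finset.univ.filter fun b' : Node K d (D.pow_nonneg (n + 1)) =>
      D.nodeAt n b'.out = b).card = Fintype.card κ ^ (d - 1) := by
    rw [← Fintype.card_subtype, ← Nat.card_eq_fintype_card, D.card_children hn,
      Nat.card_eq_fintype_card]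
  rw [Finset.prod_congr rfl fun b' hb' => if_congr (e b' (Finset.mem_filter.1 hb').2) rfl rfl,
    Finset.prod_const, hc]
  split_ifs <;> simp

open Classical in
-- First generation: at scale `1` every line is alive, so the average does not depend on `f`.
theorem sum_gen_one_add_perturb (hd : 1 ≤ d) (v : ℝ) (f : Omega K d) :
    ∑ w : Node K d (D.pow_nonneg (0 + 1)) → Fin d → κ, D.gen (0 + 1) (1 - v) (f + D.perturb 0 w)
      = (Fintype.card (Node K d (D.pow_nonneg (0 + 1)) → Fin d → κ) : ℝ) *
        (1 - v / (Fintype.card κ : ℝ) ^ (d - 1)) ^ ∑ i ∈ Finset.range d, Fintype.card κ ^ i := by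
  classical
  rw [D.sum_gen_add_perturb hd]
  congr 1
  have hal : ∀ a, Alive (r ^ 0) f a := alive_of_one_le (pow_zero r).ge f
  simp only [hal, if_true, Finset.prod_const, Finset.card_univ]
  congr 1
  rw [← Nat.card_eq_fintype_card, ← Nat.card_eq_fintype_card]
  exact D.card_node_one

end Generating

end DigitSystem

/-! ### The sequence `u`. -/

open Filter Topology

theorem u_mem_Icc {q d : ℕ} (hq : 1 ≤ q) : ∀ n, 0 ≤ u q d n ∧ u q d n ≤ 1
  | 0 => by simp [u]
  | n + 1 => by
    obtain ⟨h0, h1⟩ := u_mem_Icc (d := d) hq n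
    have hQ : (1 : ℝ) ≤ (q : ℝ) ^ (d - 1) := one_le_pow₀ (by exact_mod_cast hq)
    have hx0 : 0 ≤ u q d n / (q : ℝ) ^ (d - 1) := by positivity
    have hx1 : u q d n / (q : ℝ) ^ (d - 1) ≤ 1 := div_le_one_of_le₀ (h1.trans hQ) (by positivity)
    have := pow_le_one₀ (n := q ^ (d - 1)) (sub_nonneg.2 hx1) (sub_le_self 1 hx0)
    have := pow_nonneg (sub_nonneg.2 hx1) (q ^ (d - 1))
    rw [u]
    constructor <;> linarith

/-- The exponents match because `q^(d-1) · q^(-i) = q^(d-1-i)`; reversing the sum gives the number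
of balls of the first generation. -/
theorem one_sub_u_succ_rpow {q d : ℕ} (hq : 1 ≤ q) (n : ℕ) :
    (1 - u q d (n + 1)) ^ (∑ i ∈ Finset.range d, ((q : ℝ)⁻¹) ^ i)
      = (1 - u q d n / (q : ℝ) ^ (d - 1)) ^ ∑ i ∈ Finset.range d, q ^ i := by
  have hq0 : (q : ℝ) ≠ 0 := by exact_mod_cast (by omega : q ≠ 0)
  have hQ : (1 : ℝ) ≤ (q : ℝ) ^ (d - 1) := one_le_pow₀ (by exact_mod_cast hq)
  have hx : 0 ≤ 1 - u q d n / (q : ℝ) ^ (d - 1) :=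
    sub_nonneg.2 (div_le_one_of_le₀ ((u_mem_Icc hq n).2.trans hQ) (by positivity))
  rw [u, sub_sub_cancel, ← Real.rpow_natCast_mul hx,
    ← Real.rpow_natCast _ (∑ i ∈ Finset.range d, q ^ i)]
  congr 1
  rw [← Finset.sum_range_reflect (fun i => q ^ i), Finset.mul_sum, Nat.cast_sum]
  refine Finset.sum_congr rfl fun i hi => ?_
  have : i < d := Finset.mem_range.1 hi
  rw [Nat.cast_pow, Nat.cast_pow, inv_pow, ← div_eq_mul_inv, div_eq_iff (pow_ne_zero _ hq0),
    ← pow_add]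
  congr 1
  omega

/-! ### Haar measures on `Ω` and on `K^d`. -/

section Universe

variable {K : Type*} [NontriviallyNormedField K] {d : ℕ}

theorem nonempty_projectivization (hd : 1 ≤ d) : Nonempty (ℙ K (Fin d → K)) := by
  have : NeZero d := ⟨by omega⟩
  refine ⟨Projectivization.mk K (fun _ => 1) fun h => one_ne_zero (congrFun h 0)⟩

variable [IsUltrametricDist K]

theorem Omega.eventually_norm_sub_le (f : Omega K d) {c : ℝ} (hc : 0 < c) :
    ∀ᶠ g in 𝓝 f, ∀ a, ‖UniformFun.toFun g.1 a - UniformFun.toFun f.1 a‖ ≤ c := by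
  have h : Tendsto (fun g : Omega K d => g.1) (𝓝 f) (𝓝 f.1) := continuous_subtype_val.tendsto f
  rw [UniformFun.tendsto_iff_tendstoUniformly, Metric.tendstoUniformly_iff] at h
  filter_upwards [h c hc] with g hg a
  have := (hg a).le
  rwa [dist_comm, dist_eq_norm] at this

/-- The constant function of the universe `Ω`. -/
def Omega.const (x : Fin d → K) (hx : ‖x‖ ≤ 1) : Omega K d :=
  Omega.mk (fun _ => x) (fun _ => hx) fun _ _ => by simp

variable [CompleteSpace K] [IsDiscreteValuationRing 𝒪[K]] [Finite 𝓀[K]]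

instance : (haarOmega K d).IsAddHaarMeasure := by unfold haarOmega; infer_instance

instance : IsProbabilityMeasure (haarOmega K d) where
  measure_univ := Measure.addHaarMeasure_self

theorem integrable_of_continuous {F : Omega K d → ℝ} (hF : Continuous F) :
    Integrable F (haarOmega K d) :=
  hF.integrable_of_hasCompactSupport (HasCompactSupport.of_compactSpace F)

variable [MeasurableSpace K] [BorelSpace K]

theorem isAddHaarMeasure_haarSpace : (haarSpace K d).IsAddHaarMeasure := by
  have := properSpace K
  unfold haarSpace
  infer_instance

theorem haarSpace_closedBall : haarSpace K d (Metric.closedBall 0 1) = 1 :=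
  haveI := properSpace K
  Measure.addHaarMeasure_self

end Universe

namespace DigitSystem

/-! ### Extinction probability. -/

section Expectation

variable {K : Type*} [NontriviallyNormedField K] [IsUltrametricDist K] {r : ℝ} {κ : Type*} {d : ℕ}
  (D : DigitSystem K r κ) [∀ n, Fintype (Node K d (D.pow_nonneg n))]

theorem continuous_gen (n : ℕ) (s : ℝ) : Continuous fun f : Omega K d => D.gen n s f := by
  refine continuous_iff_continuousAt.2 fun f => ?_
  refine (continuousAt_const (y := D.gen n s f)).congr ?_
  filter_upwards [Omega.eventually_norm_sub_le f (pow_pos D.r_pos n)] with g hg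
  exact (D.gen_congr s hg).symm

variable [CompleteSpace K] [IsDiscreteValuationRing 𝒪[K]] [Finite 𝓀[K]]

open Classical in
-- This plays the role of conditioning on level `n`: by translation invariance each perturbed
-- function has the same integral, so an integrand may be replaced by its average.
theorem integral_gen_of_average [Fintype κ] {n : ℕ} {s : ℝ} {G : Omega K d → ℝ}
    (h : ∀ f, ∑ w : Node K d (D.pow_nonneg (n + 1)) → Fin d → κ,
      D.gen (n + 1) s (f + D.perturb n w)
      = (Fintype.card (Node K d (D.pow_nonneg (n + 1)) → Fin d → κ) : ℝ) * G f) :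
    ∫ f, D.gen (n + 1) s f ∂haarOmega K d = ∫ f, G f ∂haarOmega K d := by
  have hne : Nonempty κ := ⟨(D.existsUnique_digit 0 (by simp)).choose⟩
  have hW : (Fintype.card (Node K d (D.pow_nonneg (n + 1)) → Fin d → κ) : ℝ) ≠ 0 :=
    Nat.cast_ne_zero.2 Fintype.card_ne_zero
  refine mul_left_cancel₀ hW ?_
  rw [← integral_const_mul _ G, ← integral_congr_ae (ae_of_all _ h), integral_finsetSum]
  · simp only [integral_add_right_eq_self (fun f => D.gen (n + 1) s f)]
    rw [Finset.sum_const, Finset.card_univ, nsmul_eq_mul]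
  · exact fun w _ => integrable_of_continuous
      ((D.continuous_gen (n + 1) s).comp (continuous_add_const _))

/-- Going down one level turns `u_k` into `u_{k+1}`, so `k` must vary in the induction. -/
theorem integral_gen_one_sub_u [Fintype κ] (hd : 1 ≤ d) (n k : ℕ) :
    ∫ f : Omega K d, D.gen (n + 1) (1 - u (Fintype.card κ) d k) f ∂haarOmega K d
      = (1 - u (Fintype.card κ) d (n + k) / (Fintype.card κ : ℝ) ^ (d - 1))
        ^ ∑ i ∈ Finset.range d, Fintype.card κ ^ i := by
  classical
  induction n generalizing k with
  | zero =>
    rw [D.integral_gen_of_average (D.sum_gen_one_add_perturb hd _), integral_const, zero_add]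
    simp
  | succ n ih =>
    rw [D.integral_gen_of_average (D.sum_gen_add_perturb_succ hd n.succ_ne_zero _)]
    have := ih (k + 1)
    rw [u, sub_sub_cancel] at this
    rw [this, show n + 1 + k = n + (k + 1) by omega]

theorem integral_gen_zero [Fintype κ] (hd : 1 ≤ d) (n : ℕ) :
    ∫ f : Omega K d, D.gen n 0 f ∂haarOmega K d
      = (1 - u (Fintype.card κ) d n)
        ^ (∑ i ∈ Finset.range d, ((Fintype.card κ : ℝ)⁻¹) ^ i) := by
  classical
  have hq : 1 ≤ Fintype.card κ :=
    Fintype.card_pos_iff.2 ⟨(D.existsUnique_digit 0 (by simp)).choose⟩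
  cases n with
  -- At level `0` extinction is impossible, and on the right `0` is raised to a positive power.
  | zero =>
    obtain ⟨a⟩ := nonempty_projectivization (K := K) hd
    have h : ∀ f : Omega K d, D.gen 0 0 f = 0 := fun f => by
      rw [D.gen_zero, if_pos ⟨a, alive_of_one_le (pow_zero r).ge f a⟩]
    have hpos : 0 < ∑ i ∈ Finset.range d, ((Fintype.card κ : ℝ)⁻¹) ^ i :=
      Finset.sum_pos (fun i _ => by positivity) ⟨0, Finset.mem_range.2 hd⟩
    simp only [h, integral_zero, u, sub_self, Real.zero_rpow hpos.ne']
  | succ n =>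
    rw [one_sub_u_succ_rpow hq]
    have := D.integral_gen_one_sub_u hd n 0
    rwa [u, sub_self, add_zero] at this

end Expectation

/-! ### Volume of the neighbourhood, by Fubini. -/

section Neighbourhood

variable {K : Type*} [NontriviallyNormedField K] [IsUltrametricDist K] {κ : Type*} {d : ℕ}

theorem mem_kakeyaNhd_iff (D : DigitSystem K (residueCard K : ℝ)⁻¹ κ)
    (hd : 1 ≤ d) (n : ℕ)
    (f : Omega K d) {x : Fin d → K} (hx : ‖x‖ ≤ 1) :
    x ∈ kakeyaNhd n (UniformFun.toFun f.1) ↔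
      ∃ a, Alive ((residueCard K : ℝ)⁻¹ ^ n) (f - Omega.const x hx) a := by
  obtain ⟨a₀⟩ := nonempty_projectivization (K := K) hd
  have hne : (kakeyaSet (UniformFun.toFun f.1)).Nonempty :=
    ⟨_, Set.mem_iUnion.2 ⟨a₀, 0, by simp, rfl⟩⟩
  have hdist : ∀ (a : ℙ K (Fin d → K)) (t : K), dist x (t • can a + UniformFun.toFun f.1 a)
      = ‖t • can a + UniformFun.toFun (f - Omega.const x hx).1 a‖ := fun a t => by
    have : UniformFun.toFun (f - Omega.const x hx).1 a = UniformFun.toFun f.1 a - x := rfl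
    rw [this, dist_comm, dist_eq_norm, add_sub_assoc]
  constructor
  · rintro ⟨-, h⟩
    cases n with
    | zero => exact ⟨a₀, alive_of_one_le (pow_zero _).ge _ _⟩
    | succ n =>
      -- The infimum need not be known to be attained: a point at distance `< r ^ n` is
      -- automatically at distance `≤ r ^ (n + 1)`.
      obtain ⟨y, hy, hlt⟩ := (Metric.infDist_lt_iff hne).1 (h.trans_lt
        (pow_lt_pow_right_of_lt_one₀ D.r_pos D.r_lt_one n.lt_succ_self))
      obtain ⟨a, t, ht, rfl⟩ := Set.mem_iUnion.1 hy
      rw [hdist] at hlt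
      exact ⟨a, (alive_iff_exists _ _).2 ⟨t, ht, D.norm_le_pow_succ_of_lt_pow hlt⟩⟩
  · rintro ⟨a, ha⟩
    obtain ⟨t, ht, h⟩ := (alive_iff_exists _ _).1 ha
    rw [← hdist] at h
    have hmem : t • can a + UniformFun.toFun f.1 a ∈ kakeyaSet (UniformFun.toFun f.1) :=
      Set.mem_iUnion.2 ⟨a, t, ht, rfl⟩
    exact ⟨hx, (Metric.infDist_le_dist_of_mem hmem).trans h⟩

/-- Membership is locally constant in `(f, x)`. This makes the indicator jointly continuous, which
serves both the integrability of `X` and the exchange of integrals. -/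
theorem mem_kakeyaNhd_congr (D : DigitSystem K (residueCard K : ℝ)⁻¹ κ)
    (hd : 1 ≤ d)
    {n : ℕ} {f g : Omega K d} {x y : Fin d → K}
    (hfg : ∀ a, ‖UniformFun.toFun g.1 a - UniformFun.toFun f.1 a‖ ≤ (residueCard K : ℝ)⁻¹ ^ n)
    (hxy : ‖y - x‖ ≤ (residueCard K : ℝ)⁻¹ ^ n) :
    y ∈ kakeyaNhd n (UniformFun.toFun g.1) ↔ x ∈ kakeyaNhd n (UniformFun.toFun f.1) := by
  have hy_iff : ‖y‖ ≤ 1 ↔ ‖x‖ ≤ 1 :=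
    norm_le_iff_of_norm_sub_le (hxy.trans (pow_le_one₀ D.r_pos.le D.r_lt_one.le))
  by_cases hx : ‖x‖ ≤ 1
  · rw [D.mem_kakeyaNhd_iff hd n f hx, D.mem_kakeyaNhd_iff hd n g (hy_iff.2 hx)]
    refine exists_congr fun a => alive_congr_fun a ?_
    have e : UniformFun.toFun (g - Omega.const y (hy_iff.2 hx)).1 a
        - UniformFun.toFun (f - Omega.const x hx).1 a
        = (UniformFun.toFun g.1 a - UniformFun.toFun f.1 a) - (y - x) := by
      change (UniformFun.toFun g.1 a - y) - (UniformFun.toFun f.1 a - x) = _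
      abel
    rw [e]
    exact norm_sub_le_of_le (hfg a) hxy
  · exact iff_of_false (fun h => hx (hy_iff.1 h.1)) fun h => hx h.1

theorem continuous_indicator_kakeyaNhd (D : DigitSystem K (residueCard K : ℝ)⁻¹ κ)
    (hd : 1 ≤ d)
    (n : ℕ) :
    Continuous (Function.uncurry fun (f : Omega K d) (x : Fin d → K) =>
      (kakeyaNhd n (UniformFun.toFun f.1)).indicator (fun _ => (1 : ℝ)) x) := by
  classical
  refine continuous_iff_continuousAt.2 fun ⟨f, x⟩ => ?_
  refine (continuousAt_const
    (y := (kakeyaNhd n (UniformFun.toFun f.1)).indicator (fun _ => (1 : ℝ)) x)).congr ?_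
  rw [nhds_prod_eq]
  have hr := pow_pos D.r_pos n
  filter_upwards [(Omega.eventually_norm_sub_le f hr).prod_mk
    (Metric.closedBall_mem_nhds x hr)] with ⟨g, y⟩ ⟨hg, hy⟩
  change dist y x ≤ _ at hy
  rw [dist_eq_norm] at hy
  simp only [Function.uncurry_apply_pair, Set.indicator_apply, D.mem_kakeyaNhd_congr hd hg hy]

variable [CompleteSpace K] [IsDiscreteValuationRing 𝒪[K]] [Finite 𝓀[K]]

theorem hasCompactSupport_indicator_kakeyaNhd (n : ℕ) :
    HasCompactSupport (Function.uncurry fun (f : Omega K d) (x : Fin d → K) =>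
      (kakeyaNhd n (UniformFun.toFun f.1)).indicator (fun _ => (1 : ℝ)) x) := by
  have := properSpace K
  refine HasCompactSupport.intro (isCompact_univ.prod (isCompact_closedBall (0 : Fin d → K) 1)) ?_
  rintro ⟨f, x⟩ h
  have hx : x ∉ kakeyaNhd n (UniformFun.toFun f.1) := fun hx =>
    h ⟨Set.mem_univ _, by simpa using hx.1⟩
  simp [hx]

/-- Translation by the constant function `x` moves `x` to the origin, so the value is the survival
probability whatever `x` is. -/
theorem integral_indicator_kakeyaNhd_omega [Fintype κ]
    (D : DigitSystem K (residueCard K : ℝ)⁻¹ κ)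
    (hd : 1 ≤ d) (n : ℕ) {x : Fin d → K}
    (hx : ‖x‖ ≤ 1) :
    ∫ f : Omega K d, (kakeyaNhd n (UniformFun.toFun f.1)).indicator (fun _ => (1 : ℝ)) x
        ∂haarOmega K d
      = 1 - (1 - u (Fintype.card κ) d n)
        ^ (∑ i ∈ Finset.range d, ((Fintype.card κ : ℝ)⁻¹) ^ i) := by
  classical
  have : ∀ m, Fintype (Node K d (D.pow_nonneg m)) := fun m =>
    have := finite_node (K := K) (d := d) (pow_pos D.r_pos m)
    Fintype.ofFinite _
  have e : ∀ f : Omega K d, (kakeyaNhd n (UniformFun.toFun f.1)).indicator (fun _ => (1 : ℝ)) x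
      = 1 - D.gen n 0 (f + -Omega.const x hx) := fun f => by
    rw [← sub_eq_add_neg, D.gen_zero, Set.indicator_apply, D.mem_kakeyaNhd_iff hd n f hx]
    split_ifs <;> simp
  simp only [e]
  rw [integral_add_right_eq_self (fun f => 1 - D.gen n 0 f), integral_sub (integrable_const _)
    (integrable_of_continuous (D.continuous_gen n 0)), D.integral_gen_zero hd]
  simp

variable [MeasurableSpace K] [BorelSpace K]

theorem integral_indicator_kakeyaNhd (D : DigitSystem K (residueCard K : ℝ)⁻¹ κ)
    (hd : 1 ≤ d)
    (n : ℕ) (f : Omega K d) :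
    ∫ x, (kakeyaNhd n (UniformFun.toFun f.1)).indicator (fun _ => (1 : ℝ)) x ∂haarSpace K d
      = X n f := by
  have := properSpace K
  have hc := (D.continuous_indicator_kakeyaNhd hd n).uncurry_left f
  have hm : MeasurableSet (kakeyaNhd n (UniformFun.toFun f.1)) := by
    have e : kakeyaNhd n (UniformFun.toFun f.1)
        = (kakeyaNhd n (UniformFun.toFun f.1)).indicator (fun _ => (1 : ℝ)) ⁻¹' {1} := by
      ext x
      by_cases h : x ∈ kakeyaNhd n (UniformFun.toFun f.1) <;> simp [h]
    rw [e]
    exact (isClosed_singleton.preimage hc).measurableSet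
  rw [integral_indicator_const _ hm, smul_eq_mul, mul_one, X]

theorem continuous_X (D : DigitSystem K (residueCard K : ℝ)⁻¹ κ)
    (hd : 1 ≤ d) (n : ℕ) :
    Continuous fun f : Omega K d => X n f := by
  refine continuous_iff_continuousAt.2 fun f => ?_
  refine (continuousAt_const (y := X n f)).congr ?_
  filter_upwards [Omega.eventually_norm_sub_le f (pow_pos D.r_pos n)] with g hg
  have : kakeyaNhd n (UniformFun.toFun g.1) = kakeyaNhd n (UniformFun.toFun f.1) :=
    Set.ext fun x => D.mem_kakeyaNhd_congr hd hg (by simp)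
  rw [X, X, this]

theorem integral_X [Fintype κ] (D : DigitSystem K (residueCard K : ℝ)⁻¹ κ)
    (hd : 1 ≤ d) (n : ℕ) :
    ∫ f : Omega K d, X n f ∂haarOmega K d
      = 1 - (1 - u (Fintype.card κ) d n)
        ^ (∑ i ∈ Finset.range d, ((Fintype.card κ : ℝ)⁻¹) ^ i) := by
  have := properSpace K
  have := isAddHaarMeasure_haarSpace (K := K) (d := d)
  simp only [← D.integral_indicator_kakeyaNhd hd n]
  -- After the exchange, the inner integral over `Ω` is constant on the unit ball, which has measure
  -- `1`, and zero outside.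
  rw [integral_integral_swap_of_hasCompactSupport (D.continuous_indicator_kakeyaNhd hd n)
    (hasCompactSupport_indicator_kakeyaNhd n)]
  set p := 1 - (1 - u (Fintype.card κ) d n)
        ^ (∑ i ∈ Finset.range d, ((Fintype.card κ : ℝ)⁻¹) ^ i) with hp
  have e : ∀ x : Fin d → K,
      ∫ f : Omega K d, (kakeyaNhd n (UniformFun.toFun f.1)).indicator (fun _ => (1 : ℝ)) x
        ∂haarOmega K d = (Metric.closedBall 0 1).indicator (fun _ => p) x := fun x => by
    by_cases hx : ‖x‖ ≤ 1
    · rw [D.integral_indicator_kakeyaNhd_omega hd n hx, Set.indicator_of_mem (by simpa using hx)]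
    · rw [Set.indicator_of_notMem (by simpa using hx)]
      have : ∀ f : Omega K d,
          (kakeyaNhd n (UniformFun.toFun f.1)).indicator (fun _ => (1 : ℝ)) x = 0 := fun f =>
        Set.indicator_of_notMem (fun h => hx h.1) _
      simp only [this, integral_zero]
  simp only [e]
  rw [integral_indicator_const _ Metric.isClosed_closedBall.measurableSet, measureReal_def,
    haarSpace_closedBall, ENNReal.toReal_one, one_smul]

end Neighbourhood

end DigitSystem

end Kakeya

theorem theorem2 (K : Type*) [NontriviallyNormedField K] [IsUltrametricDist K]
    [CompleteSpace K] [IsDiscreteValuationRing 𝒪[K]] [Finite 𝓀[K]]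
    [MeasurableSpace K] [BorelSpace K]
    (hnorm : ∀ ϖ : 𝒪[K], Irreducible ϖ → ‖(ϖ : K)‖ = (Kakeya.residueCard K : ℝ)⁻¹)
    (d : ℕ) (hd : 2 ≤ d) (n : ℕ) :
    Integrable (fun f : Kakeya.Omega K d => Kakeya.X n f) (Kakeya.haarOmega K d) ∧
      ∫ f : Kakeya.Omega K d, Kakeya.X n f ∂(Kakeya.haarOmega K d) =
        1 - (1 - Kakeya.u (Kakeya.residueCard K) d n) ^
          (∑ i ∈ Finset.range d, ((Kakeya.residueCard K : ℝ)⁻¹) ^ i) := by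
  obtain ⟨D⟩ := Kakeya.exists_digitSystem K hnorm
  have hd' : 1 ≤ d := by omega
  have := Fintype.ofFinite 𝓀[K]
  refine ⟨Kakeya.integrable_of_continuous (D.continuous_X hd' n), ?_⟩
  have hc : Fintype.card 𝓀[K] = Kakeya.residueCard K := Nat.card_eq_fintype_card.symm
  rw [D.integral_X hd' n, hc]
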